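/- Let $\mathscr X,\mathscr Y,\mathscr U$ be finite-dimensional real vector spaces and let $A:\mathscr X\to\mathscr X$, $C:\mathscr X\to\mathscr Y$, $\bar B:\mathscr U\to\mathscr X$ be linear (for a sensor network, $C=C_i$ and $\bar B=\bar B_i$ at an arbitrary node $i$). Let $\mathbb C=\mathbb C_g\sqcup\mathbb C_b$ be a partition into two sets, each closed under complex conjugation, such that $\mathbb C_g$ contains a real number. For linear $L:\mathscr Y\to\mathscr X$ put $A_L:=A+LC$. A subspace $\mathscr W\subseteq\mathscr X$ is $(C,A)$-invariant if $A_L\mathscr W\subseteq\mathscr W$ for some $L:\mathscr Y\to\mathscr X$; such an $L$ is a friend of $\mathscr W$. A subspace $\mathscr S\subseteq\mathscr X$ is an unobservability subspace if $\mathscr S=\bigcap_{k=0}^{n-1}A_L^{-k}\,\mathrm{Ker}(HC)$ for some $L:\mathscr Y\to\mathscr X$ and $H:\mathscr Y\to\mathscr Y$, where $n=\dim\mathscr X$. Let $\mathscr W^*$ be the intersection of all $(C,A)$-invariant subspaces containing $\mathrm{Im}\,\bar B$, and $\mathscr S^*$ the intersection of all unobservability subspaces containing $\mathrm{Im}\,\bar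 B$. Let $P:\mathscr X\to\mathscr X/\mathscr W^*$ be the canonical projection. Write $\kappa(\cdot)$ for the complex spectrum of a real linear map, and let $\underline{\mathscr W_g}$ be the family of all $(C,A)$-invariant subspaces $\mathscr W\supseteq\mathrm{Im}\,\bar B$ that have a friend $L$ such that the map induced by $A_L$ on $\mathscr X/\mathscr W$ satisfies $\kappa(A_L|\mathscr X/\mathscr W)\subseteq\mathbb C_g$. Then $\mathscr W^*$ is itself $(C,A)$-invariant and $\mathscr S^*$ is itself an unobservability subspace, so each is the smallest element of its class, and $\mathscr W^*\subseteq\mathscr S^*$. Let $L$ be any friend of $\mathscr W^*$. Then $A_L\mathscr S^*\subseteq\mathscr S^*$, so that $A_L$ induces a map $A_L|\mathscr S^*/\mathscr W^*$ on $\mathscr S^*/\mathscr W^*\subseteq\mathscr X/\mathscr W^*$, and its minimal polynomial $\beta$ has a factorization $\beta=\beta_g\beta_b$ over $\mathbb R$ such that all complex zeros of $\beta_g$ lie in $\mathbb C_g$ and all complex zeros of $\beta_b$ lie in $\mathbb C_b$. For every such factorization, with $$\bar{\mathscr X}_b^*:=\mathrm{Ker}\,\beta_b\bigl(A_L|\mathscr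 S^*/\mathscr W^*\bigr)\subseteq\mathscr S^*/\mathscr W^*,$$ the subspace $$\mathscr W_g^*:=P^{-1}\bar{\mathscr X}_b^*$$ is the infimal element of $\underline{\mathscr W_g}$: it belongs to $\underline{\mathscr W_g}$ and is contained in every element of $\underline{\mathscr W_g}$. -/

import Mathlib

namespace GeometricControl

open Polynomial

section Basic

variable {X Y : Type*} [AddCommGroup X] [Module ℝ X] [AddCommGroup Y] [Module ℝ Y]

/-- The map `A_L = A + L C` obtained from `A` by the output injection `L`. -/
def outputInjection (A : X →ₗ[ℝ] X) (C : X →ₗ[ℝ] Y) (L : Y →ₗ[ℝ] X) : X →ₗ[ℝ] X :=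
  A + L ∘ₗ C

/-- The subspace `W` is invariant under `A`, that is, `A W ⊆ W`. -/
def IsInvariant (A : X →ₗ[ℝ] X) (W : Submodule ℝ X) : Prop :=
  W ≤ W.comap A

/-- `L` is a friend of `W`: `(A + L C) W ⊆ W`. -/
def IsFriend (A : X →ₗ[ℝ] X) (C : X →ₗ[ℝ] Y) (W : Submodule ℝ X) (L : Y →ₗ[ℝ] X) : Prop :=
  IsInvariant (outputInjection A C L) W

/-- `W` is `(C, A)`-invariant. -/
def IsConditionedInvariant (A : X →ₗ[ℝ] X) (C : X →ₗ[ℝ] Y) (W : Submodule ℝ X) : Prop :=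
  ∃ L : Y →ₗ[ℝ] X, IsFriend A C W L

/-- The class of `(C, A)`-invariant subspaces containing `𝓑`. -/
def conditionedInvariants (A : X →ₗ[ℝ] X) (C : X →ₗ[ℝ] Y) (𝓑 : Submodule ℝ X) :
    Set (Submodule ℝ X) :=
  {W | IsConditionedInvariant A C W ∧ 𝓑 ≤ W}

/-- `W^*(C, A; 𝓑)`, the infimum of the class of `(C, A)`-invariant subspaces containing `𝓑`. -/
noncomputable def wStar (A : X →ₗ[ℝ] X) (C : X →ₗ[ℝ] Y) (𝓑 : Submodule ℝ X) : Submodule ℝ X :=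
  sInf (conditionedInvariants A C 𝓑)

/-- `⟨K | A⟩ = K ∩ A⁻¹ K ∩ ⋯ ∩ A^{-(n-1)} K`, where `n = dim X`. -/
noncomputable def unobservableIn (K : Submodule ℝ X) (A : X →ₗ[ℝ] X) : Submodule ℝ X :=
  ⨅ k : Fin (Module.finrank ℝ X), K.comap (A ^ (k : ℕ))

/-- `S` is an unobservability subspace: `S = ⟨Ker (H C) | A + L C⟩` for some output injection `L`
and some measurement mixing map `H`. -/
def IsUnobservabilitySubspace (A : X →ₗ[ℝ] X) (C : X →ₗ[ℝ] Y) (S : Submodule ℝ X) : Prop :=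
  ∃ (L : Y →ₗ[ℝ] X) (H : Y →ₗ[ℝ] Y),
    S = unobservableIn (LinearMap.ker (H ∘ₗ C)) (outputInjection A C L)

/-- The class of unobservability subspaces containing `𝓑`. -/
def unobservabilitySubspaces (A : X →ₗ[ℝ] X) (C : X →ₗ[ℝ] Y) (𝓑 : Submodule ℝ X) :
    Set (Submodule ℝ X) :=
  {S | IsUnobservabilitySubspace A C S ∧ 𝓑 ≤ S}

/-- `S^*(C, A; 𝓑)`, the infimum of the class of unobservability subspaces containing `𝓑`. -/
noncomputable def sStar (A : X →ₗ[ℝ] X) (C : X →ₗ[ℝ] Y) (𝓑 : Submodule ℝ X) : Submodule ℝ X :=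
  sInf (unobservabilitySubspaces A C 𝓑)

/-- The map `A | X/W` induced on `X/W` by `A`, for an `A`-invariant subspace `W`. -/
def inducedMap (A : X →ₗ[ℝ] X) (W : Submodule ℝ X) (hW : IsInvariant A W) :
    (X ⧸ W) →ₗ[ℝ] (X ⧸ W) :=
  W.mapQ W A hW

/-- `S/W` as a subspace of `X/W`. -/
def subquotient (S W : Submodule ℝ X) : Submodule ℝ (X ⧸ W) :=
  S.map W.mkQ

theorem subquotient_invariant (A : X →ₗ[ℝ] X) (S W : Submodule ℝ X)
    (hS : IsInvariant A S) (hW : IsInvariant A W) :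
    ∀ x ∈ subquotient S W, inducedMap A W hW x ∈ subquotient S W := by
  rintro _ ⟨s, hs, rfl⟩
  exact ⟨A s, hS hs, rfl⟩

/-- The map `A | S/W`, the restriction to `S/W` of the map induced on `X/W` by `A`. -/
def subquotientMap (A : X →ₗ[ℝ] X) (S W : Submodule ℝ X)
    (hS : IsInvariant A S) (hW : IsInvariant A W) :
    subquotient S W →ₗ[ℝ] subquotient S W :=
  (inducedMap A W hW).restrict (subquotient_invariant A S W hS hW)

end Basic

/-- The spectrum `κ(f)` of an endomorphism of a finite-dimensional real space: the complex zeros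
of its characteristic polynomial, with multiplicity. -/
noncomputable def spec {V : Type*} [AddCommGroup V] [Module ℝ V] [FiniteDimensional ℝ V]
    (f : V →ₗ[ℝ] V) : Multiset ℂ :=
  f.charpoly.aroots ℂ

/-- `ℂ = Cg ∪ Cb` is a partition, symmetric with respect to the real axis, whose good part
contains a real number. -/
structure IsSymmetricPartition (Cg Cb : Set ℂ) : Prop where
  union_eq : Cg ∪ Cb = Set.univ
  inter_eq : Cg ∩ Cb = ∅
  conj_good : ∀ z ∈ Cg, (starRingEnd ℂ) z ∈ Cg
  conj_bad : ∀ z ∈ Cb, (starRingEnd ℂ) z ∈ Cb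
  exists_real_good : ∃ r : ℝ, (r : ℂ) ∈ Cg

/-- `β = βg βb`, where the complex zeros of `βg` are good and those of `βb` are bad. -/
structure IsGoodBadFactorization (Cg Cb : Set ℂ) (β βg βb : ℝ[X]) : Prop where
  eq_mul : β = βg * βb
  good : ∀ z : ℂ, aeval z βg = 0 → z ∈ Cg
  bad : ∀ z : ℂ, aeval z βb = 0 → z ∈ Cb

/-- The `(C, A)`-invariant subspaces `W` containing `𝓑` that have a friend `L` such that the
spectrum of the map induced on `X/W` by `A + L C` is good. -/
def goodFamily {X Y : Type*} [AddCommGroup X] [Module ℝ X] [FiniteDimensional ℝ X]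
    [AddCommGroup Y] [Module ℝ Y] (A : X →ₗ[ℝ] X) (C : X →ₗ[ℝ] Y) (𝓑 : Submodule ℝ X)
    (Cg : Set ℂ) : Set (Submodule ℝ X) :=
  {W | W ∈ conditionedInvariants A C 𝓑 ∧
    ∃ (L : Y →ₗ[ℝ] X) (hL : IsFriend A C W L),
      ∀ z ∈ spec (inducedMap (outputInjection A C L) W hL), z ∈ Cg}

/-- `Ker β(A | S/W)`, as a subspace of `X/W` contained in `S/W`. -/
noncomputable def modalSubspace {X : Type*} [AddCommGroup X] [Module ℝ X]
    (A : X →ₗ[ℝ] X) (S W : Submodule ℝ X) (hS : IsInvariant A S) (hW : IsInvariant A W)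
    (β : ℝ[X]) : Submodule ℝ (X ⧸ W) :=
  (LinearMap.ker (aeval (subquotientMap A S W hS hW) β)).map (subquotient S W).subtype

end GeometricControl

/-! By `isConditionedInvariant_iff`, (C,A)-invariance means A(W ∩ Ker C) ⊆ W, which survives
intersections; so W* is attained. If L is a friend of W* and M a friend of some V ⊇ W*, then A_L and
A_M agree modulo V on W* + Ker C (`IsFriend.sub_mem`). Hence S* = ⟨W* + Ker C | A_L⟩ for every
friend L, and polynomials in A_L and A_M agree on S* modulo V.

Membership: the pair induced on X/S* is observable, so L can be changed to some M, with A_M = A_L on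
S*, such that A_M − r is nilpotent on X/S*, r being a good real number; below S*, β_g(A_L) carries
S* into W_g*. Minimality: if p has good zeros and p(A_M) carries X into V, then p is coprime to β_b.
For x ∈ W_g* both p(A_M)x and β_b(A_M)x lie in V, so x ∈ V by Bézout. -/

namespace GeometricControl

open Polynomial

/-! ### Output injections, conditioned invariance and nilpotency. -/

section OutputInjection

variable {X Y : Type*} [AddCommGroup X] [Module ℝ X] [AddCommGroup Y] [Module ℝ Y]

@[simp]
theorem outputInjection_apply (A : X →ₗ[ℝ] X) (C : X →ₗ[ℝ] Y) (L : Y →ₗ[ℝ] X) (x : X) :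
    outputInjection A C L x = A x + L (C x) := rfl

/-- An output injection carries `V` into `W` as soon as `A` carries `V ∩ Ker C` into `W`. -/
theorem exists_outputInjection_map_le (A : X →ₗ[ℝ] X) (C : X →ₗ[ℝ] Y) (V W : Submodule ℝ X)
    (h : ∀ v ∈ V, C v = 0 → A v ∈ W) :
    ∃ L : Y →ₗ[ℝ] X, ∀ v ∈ V, outputInjection A C L v ∈ W := by
  -- With s a section of C : V → C V and L = −A s on C V, A_L v = A(v − s C v), where v − s C v ∈ V
  -- ∩ Ker C.
  obtain ⟨s, hs⟩ := LinearMap.exists_rightInverse_of_surjective (C.domRestrict V).rangeRestrict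
    (LinearMap.range_rangeRestrict _)
  obtain ⟨L, hL⟩ := LinearMap.exists_extend (-(A ∘ₗ V.subtype ∘ₗ s))
  refine ⟨L, fun v hv => ?_⟩
  set y := (C.domRestrict V).rangeRestrict ⟨v, hv⟩ with hy
  have hLy : L (C v) = -A (s y) := LinearMap.congr_fun hL y
  have hCs : C (s y) = C v := congrArg Subtype.val (LinearMap.congr_fun hs y)
  have := h (v - s y) (V.sub_mem hv (s y).2) (by rw [map_sub, hCs, sub_self])
  simpa [hLy, sub_eq_add_neg] using this

/-- `W` is `(C, A)`-invariant if and only if `A (W ∩ Ker C) ⊆ W`. -/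
theorem isConditionedInvariant_iff {A : X →ₗ[ℝ] X} {C : X →ₗ[ℝ] Y} {W : Submodule ℝ X} :
    IsConditionedInvariant A C W ↔ ∀ w ∈ W, C w = 0 → A w ∈ W := by
  refine ⟨fun ⟨L, hL⟩ w hw hCw => ?_, fun h => ?_⟩
  · simpa [hCw] using hL hw
  · obtain ⟨L, hL⟩ := exists_outputInjection_map_le A C W W h
    exact ⟨L, fun w hw => hL w hw⟩

theorem isLeast_wStar (A : X →ₗ[ℝ] X) (C : X →ₗ[ℝ] Y) (𝓑 : Submodule ℝ X) :
    IsLeast (conditionedInvariants A C 𝓑) (wStar A C 𝓑) := by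
  refine ⟨⟨isConditionedInvariant_iff.2 fun w hw hCw => ?_, le_sInf fun W hW => hW.2⟩,
    fun W hW => sInf_le hW⟩
  rw [wStar, Submodule.mem_sInf] at hw ⊢
  exact fun W hW => isConditionedInvariant_iff.1 hW.1 w (hw W hW) hCw

/-- A single output injection shifts a whole terminating descending chain if `A` shifts the
intersections of its members with `Ker C`. -/
theorem exists_outputInjection_shift (A : X →ₗ[ℝ] X) (C : X →ₗ[ℝ] Y) (T : ℕ → Submodule ℝ X)
    (hT : Antitone T) (h : ∀ k, ∀ x ∈ T k, C x = 0 → A x ∈ T (k + 1)) (N : ℕ) (hN : T N = ⊥) :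
    ∃ L : Y →ₗ[ℝ] X, ∀ k, ∀ x ∈ T k, outputInjection A C L x ∈ T (k + 1) := by
  -- Downward induction along the chain, starting at T N = 0, where any L works.
  suffices H : ∀ j ≤ N, ∃ L : Y →ₗ[ℝ] X, ∀ k, N - j ≤ k → ∀ x ∈ T k,
      outputInjection A C L x ∈ T (k + 1) by
    obtain ⟨L, hL⟩ := H N le_rfl
    exact ⟨L, fun k => hL k (by lia)⟩
  intro j
  induction j with
  | zero =>
    refine fun _ => ⟨0, fun k hk x hx => ?_⟩
    have hx0 : x = 0 := (Submodule.mem_bot ℝ).1 (hN ▸ hT hk hx)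
    simp [hx0]
  | succ j ih =>
    intro hj
    obtain ⟨L, hL⟩ := ih (by lia)
    obtain ⟨m, hm, hmj⟩ : ∃ m, m = N - (j + 1) ∧ N - j = m + 1 := ⟨_, rfl, by lia⟩
    rw [hmj] at hL
    obtain ⟨M, hM⟩ := exists_outputInjection_map_le A C (T m) (T (m + 1)) (h m)
    -- ρ projects Y onto C(T (m+1)): the old L is kept there and M is used on Ker ρ. If ρ(C x) = C
    -- w, the new map sends x to A_M(x − w) + A_L w.
    obtain ⟨π, hπ⟩ := LinearMap.exists_leftInverse_of_injective
      ((T (m + 1)).map C).subtype (Submodule.ker_subtype _)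
    set ρ := ((T (m + 1)).map C).subtype ∘ₗ π
    have hρ : ∀ x ∈ T (m + 1), ρ (C x) = C x := fun x hx =>
      congrArg Subtype.val (LinearMap.congr_fun hπ ⟨C x, Submodule.mem_map_of_mem hx⟩)
    refine ⟨L ∘ₗ ρ + M ∘ₗ (LinearMap.id - ρ), fun k hmk x hx => ?_⟩
    rcases eq_or_lt_of_le hmk with hkm | hkm
    · obtain rfl : k = m := by lia
      obtain ⟨w, hw, hwx⟩ : ∃ w ∈ T (k + 1), C w = ρ (C x) := (π (C x)).2
      have h1 := hM (x - w) ((T k).sub_mem hx (hT k.le_succ hw))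
      have h2 := hT (k + 1).le_succ (hL (k + 1) le_rfl w hw)
      convert (T (k + 1)).add_mem h1 h2 using 1
      simp only [outputInjection_apply, LinearMap.add_apply, LinearMap.comp_apply,
        LinearMap.sub_apply, LinearMap.id_apply, map_sub, ← hwx]
      abel
    · simpa [hρ x (hT (by lia) hx)] using hL k (by lia) x hx

/-- A pair without nonzero unobservable invariant subspace is made nilpotent by an output
injection. -/
theorem exists_isNilpotent_outputInjection [FiniteDimensional ℝ X] (A : X →ₗ[ℝ] X)
    (C : X →ₗ[ℝ] Y)
    (hobs : ∀ V : Submodule ℝ X, IsInvariant A V → V ≤ LinearMap.ker C → V = ⊥) :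
    ∃ L : Y →ₗ[ℝ] X, IsNilpotent (outputInjection A C L) := by
  let F : Submodule ℝ X → Submodule ℝ X := fun V => (V ⊓ LinearMap.ker C).map A
  have hF : Monotone F := fun V V' h => Submodule.map_mono (inf_le_inf_right _ h)
  let T : ℕ → Submodule ℝ X := fun k => F^[k] ⊤
  have hTs : ∀ k, T (k + 1) = F (T k) := fun k => Function.iterate_succ_apply' F k ⊤
  have hT : Antitone T := hF.antitone_iterate_of_map_le le_top
  obtain ⟨N, hN⟩ := IsArtinian.monotone_stabilizes
    (⟨fun k => OrderDual.toDual (T k), fun _ _ h => hT h⟩ : ℕ →o (Submodule ℝ X)ᵒᵈ)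
  have hfix : T N = F (T N) := (hN (N + 1) N.le_succ).trans (hTs N)
  -- T N = A(T N ∩ Ker C) forces dim T N ≤ dim(T N ∩ Ker C), so the limit lies in Ker C and is
  -- A-invariant.
  have hle : T N ⊓ LinearMap.ker C = T N := by
    refine Submodule.eq_of_le_of_finrank_le inf_le_left ?_
    conv_lhs => rw [hfix]
    exact Submodule.finrank_map_le _ _
  have hbot : T N = ⊥ := by
    refine hobs (T N) (fun x hx => ?_) (inf_eq_left.1 hle)
    rw [Submodule.mem_comap, hfix]
    exact Submodule.mem_map_of_mem (hle.symm ▸ hx)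
  obtain ⟨L, hL⟩ := exists_outputInjection_shift A C T hT
    (fun k x hx hCx => hTs k ▸ Submodule.mem_map_of_mem ⟨hx, hCx⟩) N hbot
  refine ⟨L, N, LinearMap.ext fun x => ?_⟩
  have hpow : ∀ k, (outputInjection A C L ^ k) x ∈ T k := by
    intro k
    induction k with
    | zero => exact Submodule.mem_top
    | succ k ih => simpa only [pow_succ', Module.End.mul_apply] using hL k _ ih
  exact (Submodule.mem_bot ℝ).1 (hbot ▸ hpow N)

end OutputInjection

/-! ### Unobservability subspaces and the formula for S*. -/

section Unobservable

variable {X Y : Type*} [AddCommGroup X] [Module ℝ X] [AddCommGroup Y] [Module ℝ Y]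

theorem IsInvariant.pow_mem {A : X →ₗ[ℝ] X} {V : Submodule ℝ X} (hV : IsInvariant A V) (k : ℕ)
    {x : X} (hx : x ∈ V) : (A ^ k) x ∈ V := by
  induction k with
  | zero => exact hx
  | succ k ih =>
    rw [pow_succ', Module.End.mul_apply]
    exact hV ih

theorem IsInvariant.aeval_mem {A : X →ₗ[ℝ] X} {V : Submodule ℝ X} (hV : IsInvariant A V)
    (p : ℝ[X]) {x : X} (hx : x ∈ V) : aeval A p x ∈ V := by
  rw [aeval_eq_sum_range, LinearMap.sum_apply]
  exact V.sum_mem fun k _ => V.smul_mem _ (hV.pow_mem k hx)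

theorem IsInvariant.le_unobservableIn {A : X →ₗ[ℝ] X} {K V : Submodule ℝ X}
    (hV : IsInvariant A V) (hVK : V ≤ K) : V ≤ unobservableIn K A :=
  le_iInf fun k _ hx => hVK (hV.pow_mem k hx)

/-- Cayley–Hamilton: every power of A is a combination of the first dim X powers. -/
theorem mem_unobservableIn_iff [FiniteDimensional ℝ X] {A : X →ₗ[ℝ] X} {K : Submodule ℝ X}
    {x : X} : x ∈ unobservableIn K A ↔ ∀ k : ℕ, (A ^ k) x ∈ K := by
  simp only [unobservableIn, Submodule.mem_iInf, Submodule.mem_comap]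
  refine ⟨fun h k => ?_, fun h k => h k⟩
  rw [LinearMap.pow_eq_aeval_mod_charpoly]
  by_cases hn : Module.finrank ℝ X = 0
  · have := Module.finrank_zero_iff.1 hn
    rw [Subsingleton.elim (aeval A _ x) 0]
    exact K.zero_mem
  have hdeg : (Polynomial.X ^ k %ₘ A.charpoly).natDegree < Module.finrank ℝ X := by
    rw [← A.charpoly_natDegree]
    refine natDegree_modByMonic_lt _ A.charpoly_monic fun h1 => hn ?_
    rw [← A.charpoly_natDegree, h1, natDegree_one]
  rw [aeval_eq_sum_range' hdeg, LinearMap.sum_apply]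
  exact K.sum_mem fun i hi => K.smul_mem _ (h ⟨i, Finset.mem_range.1 hi⟩)

theorem unobservableIn_le [FiniteDimensional ℝ X] (K : Submodule ℝ X) (A : X →ₗ[ℝ] X) :
    unobservableIn K A ≤ K :=
  fun _ hx => mem_unobservableIn_iff.1 hx 0

theorem isInvariant_unobservableIn [FiniteDimensional ℝ X] (K : Submodule ℝ X)
    (A : X →ₗ[ℝ] X) : IsInvariant A (unobservableIn K A) := fun x hx =>
  mem_unobservableIn_iff.2 fun k => by
    simpa only [pow_succ, Module.End.mul_apply] using mem_unobservableIn_iff.1 hx (k + 1)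

/-- Every subspace of the form `W + Ker C` is the kernel of `H C` for some `H`. -/
theorem exists_ker_comp_eq_sup (C : X →ₗ[ℝ] Y) (W : Submodule ℝ X) :
    ∃ H : Y →ₗ[ℝ] Y, LinearMap.ker (H ∘ₗ C) = W ⊔ LinearMap.ker C := by
  obtain ⟨Q, hQ⟩ := (W.map C).exists_isCompl
  refine ⟨Q.subtype ∘ₗ Q.projectionOnto (W.map C) hQ.symm, ?_⟩
  rw [LinearMap.ker_comp, LinearMap.ker_comp_of_ker_eq_bot _ (Submodule.ker_subtype _),
    Submodule.ker_projectionOnto, Submodule.comap_map_eq]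

variable {A : X →ₗ[ℝ] X} {C : X →ₗ[ℝ] Y} {𝓑 : Submodule ℝ X}

/-- If `L` is a friend of `W` and `M` is a friend of `V ⊇ W`, then `A + L C` and `A + M C` agree
on `W + Ker C` modulo `V`. -/
theorem IsFriend.sub_mem {W V : Submodule ℝ X} {L M : Y →ₗ[ℝ] X} (hL : IsFriend A C W L)
    (hM : IsFriend A C V M) (hWV : W ≤ V) {x : X} (hx : x ∈ W ⊔ LinearMap.ker C) :
    outputInjection A C M x - outputInjection A C L x ∈ V := by
  obtain ⟨w, hw, k, hk, rfl⟩ := Submodule.mem_sup.1 hx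
  rw [LinearMap.mem_ker] at hk
  convert V.sub_mem (hM (hWV hw)) (hWV (hL hw)) using 1
  simp only [outputInjection_apply, map_add, hk, map_zero]
  abel

variable [FiniteDimensional ℝ X]

/-- For a competitor T with friend M, the sum S + T is A_M-invariant, as A_M and A_L agree on S
modulo T. It lies in Ker(GC), so it is contained in T. -/
theorem isLeast_unobservableIn_sup_ker {W : Submodule ℝ X}
    (hW : IsLeast (conditionedInvariants A C 𝓑) W) {L : Y →ₗ[ℝ] X} (hL : IsFriend A C W L) :
    IsLeast (unobservabilitySubspaces A C 𝓑)
      (unobservableIn (W ⊔ LinearMap.ker C) (outputInjection A C L)) := by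
  obtain ⟨H, hH⟩ := exists_ker_comp_eq_sup C W
  refine ⟨⟨⟨L, H, by rw [hH]⟩, hW.1.2.trans (hL.le_unobservableIn le_sup_left)⟩, ?_⟩
  rintro T ⟨⟨M, G, rfl⟩, h𝓑T⟩
  set S := unobservableIn (W ⊔ LinearMap.ker C) (outputInjection A C L) with hS
  set T := unobservableIn (LinearMap.ker (G ∘ₗ C)) (outputInjection A C M) with hT
  have hM : IsFriend A C T M := isInvariant_unobservableIn _ _
  have hWT : W ≤ T := hW.2 ⟨⟨M, hM⟩, h𝓑T⟩
  have hTK : T ≤ LinearMap.ker (G ∘ₗ C) := unobservableIn_le _ _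
  have hSK : S ≤ W ⊔ LinearMap.ker C := unobservableIn_le _ _
  have hinv : IsInvariant (outputInjection A C M) (S ⊔ T) := by
    refine sup_le (fun s hs => ?_) fun t ht => ?_
    · have h1 : outputInjection A C L s ∈ S := isInvariant_unobservableIn _ _ hs
      have h2 := hL.sub_mem hM hWT (hSK hs)
      rw [Submodule.mem_comap, ← add_sub_cancel (outputInjection A C L s)
        (outputInjection A C M s)]
      exact Submodule.add_mem_sup h1 h2
    · exact Submodule.mem_sup_right (hM ht)
  exact le_sup_left.trans (hinv.le_unobservableIn (sup_le (hSK.trans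
    (sup_le (hWT.trans hTK) (LinearMap.ker_le_ker_comp _ _))) hTK))

theorem sStar_eq_unobservableIn {L : Y →ₗ[ℝ] X} (hL : IsFriend A C (wStar A C 𝓑) L) :
    sStar A C 𝓑 =
      unobservableIn (wStar A C 𝓑 ⊔ LinearMap.ker C) (outputInjection A C L) :=
  (isLeast_unobservableIn_sup_ker (isLeast_wStar A C 𝓑) hL).isGLB.sInf_eq

end Unobservable

/-! ### Spectra, annihilating polynomials and good-bad factorizations. -/

section Spectrum

theorem aeval_semiconj {V V' : Type*} [AddCommGroup V] [Module ℝ V] [AddCommGroup V'] [Module ℝ V']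
    {f : V →ₗ[ℝ] V} {f' : V' →ₗ[ℝ] V'} {g : V →ₗ[ℝ] V'} (h : ∀ x, g (f x) = f' (g x))
    (p : ℝ[X]) (x : V) : g (aeval f p x) = aeval f' p (g x) := by
  have hpow : ∀ k : ℕ, g ((f ^ k) x) = (f' ^ k) (g x) := by
    intro k
    induction k with
    | zero => rfl
    | succ k ih => simp only [pow_succ', Module.End.mul_apply, h, ih]
  simp only [aeval_eq_sum_range, LinearMap.sum_apply, LinearMap.smul_apply, map_sum, map_smul,
    hpow]

/-- The spectrum of `f` lies in `Cg` if and only if `f` is annihilated by a polynomial all of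
whose complex zeros lie in `Cg`. -/
theorem spec_subset_iff {V : Type*} [AddCommGroup V] [Module ℝ V] [FiniteDimensional ℝ V]
    (f : V →ₗ[ℝ] V) (Cg : Set ℂ) :
    (∀ z ∈ spec f, z ∈ Cg) ↔
      ∃ p : ℝ[X], aeval f p = 0 ∧ ∀ z : ℂ, aeval z p = 0 → z ∈ Cg := by
  have hmem : ∀ z : ℂ, z ∈ spec f ↔ aeval z f.charpoly = 0 := fun z => by
    simp [spec, f.charpoly_monic.ne_zero]
  simp only [hmem]
  refine ⟨fun h => ⟨f.charpoly, f.aeval_self_charpoly, h⟩, fun ⟨p, hp, hgood⟩ z hz => hgood z ?_⟩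
  have hroot : (f.baseChange ℂ).charpoly.IsRoot z := by
    rw [LinearMap.charpoly_baseChange, IsRoot.def, eval_map_algebraMap, hz]
  obtain ⟨v, hv⟩ :=
    ((Module.End.hasEigenvalue_iff_isRoot_charpoly _ _).2 hroot).exists_hasEigenvector
  have hann : aeval (f.baseChange ℂ) (p.map (algebraMap ℝ ℂ)) = 0 := by
    rw [aeval_map_algebraMap]
    have := aeval_algHom_apply (Module.End.baseChangeHom ℝ ℂ V) f p
    rwa [hp, map_zero] at this
  have := Module.End.aeval_apply_of_hasEigenvector (p := p.map (algebraMap ℝ ℂ)) hv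
  rw [hann, LinearMap.zero_apply, eval_map_algebraMap] at this
  exact (smul_eq_zero.1 this.symm).resolve_right hv.2

/-- All complex zeros of an irreducible real polynomial lie in the same part of a symmetric
partition. -/
theorem IsSymmetricPartition.forall_mem_or_of_irreducible {Cg Cb : Set ℂ}
    (hC : IsSymmetricPartition Cg Cb) {p : ℝ[X]} (hp : Irreducible p) :
    (∀ z : ℂ, aeval z p = 0 → z ∈ Cg) ∨ (∀ z : ℂ, aeval z p = 0 → z ∈ Cb) := by
  by_contra! hcon
  obtain ⟨⟨z, hz, hzg⟩, w, hw, hwb⟩ := hcon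
  have hzb : z ∈ Cb := (hC.union_eq ▸ Set.mem_univ z).resolve_left hzg
  -- Zeros of an irreducible polynomial are conjugate under Gal(ℂ/ℝ), which has only the identity
  -- and complex conjugation.
  have : Normal ℝ ℂ := normal_iff.2 fun x =>
    ⟨Algebra.IsIntegral.isIntegral x, IsAlgClosed.splits _⟩
  obtain ⟨σ, rfl⟩ : ∃ σ : ℂ ≃ₐ[ℝ] ℂ, σ z = w := by
    refine isConjRoot_iff_exists_algEquiv.1 ?_
    rw [isConjRoot_def, ← minpoly.eq_of_irreducible hp hw, ← minpoly.eq_of_irreducible hp hz]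
  rcases Complex.real_algHom_eq_id_or_conj (σ : ℂ →ₐ[ℝ] ℂ) with h | h
  · exact hwb ((DFunLike.congr_fun h z : σ z = z).symm ▸ hzb)
  · exact hwb ((DFunLike.congr_fun h z : σ z = (starRingEnd ℂ) z).symm ▸ hC.conj_bad z hzb)

theorem IsSymmetricPartition.exists_factorization {Cg Cb : Set ℂ}
    (hC : IsSymmetricPartition Cg Cb) (β : ℝ[X]) (hβ : β ≠ 0) :
    ∃ βg βb : ℝ[X], IsGoodBadFactorization Cg Cb β βg βb := by
  induction β using WfDvdMonoid.induction_on_irreducible with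
  | zero => exact absurd rfl hβ
  | unit u hu =>
    refine ⟨u, 1, (mul_one u).symm, fun z hz => ?_, fun z hz => ?_⟩
    · exact absurd hz (hu.map (aeval z)).ne_zero
    · simp at hz
  | mul a i ha hi ih =>
    obtain ⟨βg, βb, h, hg, hb⟩ := ih ha
    rcases hC.forall_mem_or_of_irreducible hi with hig | hib
    · refine ⟨i * βg, βb, by rw [h, mul_assoc], fun z hz => ?_, hb⟩
      rw [map_mul, mul_eq_zero] at hz
      exact hz.elim (hig z) (hg z)
    · refine ⟨βg, i * βb, by rw [h, mul_left_comm], hg, fun z hz => ?_⟩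
      rw [map_mul, mul_eq_zero] at hz
      exact hz.elim (hib z) (hb z)

theorem IsSymmetricPartition.isCoprime {Cg Cb : Set ℂ} (hC : IsSymmetricPartition Cg Cb)
    {p q : ℝ[X]} (hp : ∀ z : ℂ, aeval z p = 0 → z ∈ Cg) (hq : ∀ z : ℂ, aeval z q = 0 → z ∈ Cb) :
    IsCoprime p q := by
  refine (isCoprime_iff_aeval_ne_zero_of_isAlgClosed ℝ ℂ p q).2 fun z => ?_
  by_contra! h
  exact (hC.inter_eq ▸ (⟨hp z h.1, hq z h.2⟩ : z ∈ Cg ∩ Cb) : z ∈ (∅ : Set ℂ))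

end Spectrum

/-! ### The least element of the good family. -/

section GoodFamily

variable {X Y : Type*} [AddCommGroup X] [Module ℝ X] [AddCommGroup Y] [Module ℝ Y]

theorem mem_comap_modalSubspace_iff {A : X →ₗ[ℝ] X} {S W : Submodule ℝ X}
    (hS : IsInvariant A S) (hW : IsInvariant A W) (hWS : W ≤ S) (β : ℝ[X]) (x : X) :
    x ∈ (modalSubspace A S W hS hW β).comap W.mkQ ↔ x ∈ S ∧ aeval A β x ∈ W := by
  have key : ∀ y : subquotient S W,
      (aeval (subquotientMap A S W hS hW) β y : X ⧸ W) = aeval (inducedMap A W hW) β y :=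
    aeval_semiconj (g := (subquotient S W).subtype) (fun _ => rfl) β
  have key' : W.mkQ (aeval A β x) = aeval (inducedMap A W hW) β (W.mkQ x) :=
    aeval_semiconj (g := W.mkQ) (fun _ => rfl) β x
  have hxS : W.mkQ x ∈ subquotient S W ↔ x ∈ S := by
    rw [subquotient, ← Submodule.mem_comap, Submodule.comap_map_mkQ, sup_eq_right.2 hWS]
  rw [← hxS, ← Submodule.Quotient.mk_eq_zero W, ← Submodule.mkQ_apply, key', Submodule.mem_comap,
    modalSubspace, Submodule.mem_map]
  constructor
  · rintro ⟨y, hy, hyx⟩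
    refine ⟨hyx ▸ y.2, ?_⟩
    rw [← hyx, Submodule.subtype_apply, ← key, LinearMap.mem_ker.1 hy, Submodule.coe_zero]
  · rintro ⟨hx, h0⟩
    exact ⟨⟨_, hx⟩, LinearMap.mem_ker.2 (Subtype.ext ((key _).trans h0)), rfl⟩

theorem aeval_minpoly_subquotientMap_mem {A : X →ₗ[ℝ] X} {S W : Submodule ℝ X}
    (hS : IsInvariant A S) (hW : IsInvariant A W) (hWS : W ≤ S) {x : X} (hx : x ∈ S) :
    aeval A (minpoly ℝ (subquotientMap A S W hS hW)) x ∈ W := by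
  refine ((mem_comap_modalSubspace_iff hS hW hWS _ x).1 ?_).2
  have h0 : aeval (subquotientMap A S W hS hW) (minpoly ℝ (subquotientMap A S W hS hW)) = 0 :=
    minpoly.aeval ℝ (subquotientMap A S W hS hW)
  rw [Submodule.mem_comap, modalSubspace, h0, LinearMap.ker_zero, Submodule.map_top,
    Submodule.range_subtype]
  exact Submodule.mem_map_of_mem hx

/-- Removes quotients and spectra, so that the rest is polynomial algebra on X. -/
theorem mem_goodFamily_iff [FiniteDimensional ℝ X] {A : X →ₗ[ℝ] X} {C : X →ₗ[ℝ] Y}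
    {𝓑 : Submodule ℝ X} {Cg : Set ℂ} {V : Submodule ℝ X} :
    V ∈ goodFamily A C 𝓑 Cg ↔ 𝓑 ≤ V ∧ ∃ L, IsFriend A C V L ∧
      ∃ p : ℝ[X], (∀ x, aeval (outputInjection A C L) p x ∈ V) ∧
        ∀ z : ℂ, aeval z p = 0 → z ∈ Cg := by
  have key : ∀ (L : Y →ₗ[ℝ] X) (hL : IsFriend A C V L) (p : ℝ[X]),
      aeval (inducedMap (outputInjection A C L) V hL) p = 0 ↔
        ∀ x, aeval (outputInjection A C L) p x ∈ V := fun L hL p => by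
    have h : ∀ x, V.mkQ (aeval (outputInjection A C L) p x) =
        aeval (inducedMap (outputInjection A C L) V hL) p (V.mkQ x) :=
      aeval_semiconj (g := V.mkQ) (fun _ => rfl) p
    simp only [← Submodule.Quotient.mk_eq_zero V, ← Submodule.mkQ_apply, h]
    exact ⟨fun h0 x => by rw [h0, LinearMap.zero_apply],
      fun h0 => LinearMap.ext (V.mkQ_surjective.forall.2 h0)⟩
  simp only [goodFamily, Set.mem_ofPred_eq, conditionedInvariants, spec_subset_iff, key]
  constructor
  · rintro ⟨⟨-, h𝓑⟩, L, hL, p, hp⟩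
    exact ⟨h𝓑, L, hL, p, hp⟩
  · rintro ⟨h𝓑, L, hL, p, hp⟩
    exact ⟨⟨⟨L, hL⟩, h𝓑⟩, L, hL, p, hp⟩

variable {A : X →ₗ[ℝ] X} {C : X →ₗ[ℝ] Y} {W : Submodule ℝ X} {L : Y →ₗ[ℝ] X}

/-- If `S = ⟨W + Ker C | A + L C⟩`, the spectrum on `X/S` can be moved to any real number `r` by
an output injection that does not change `A + L C` on `S`. -/
theorem exists_outputInjection_shift_quotient [FiniteDimensional ℝ X] {S : Submodule ℝ X}
    (hS : S = unobservableIn (W ⊔ LinearMap.ker C) (outputInjection A C L)) (r : ℝ) :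
    ∃ (M : Y →ₗ[ℝ] X) (n : ℕ),
      (∀ s ∈ S, outputInjection A C M s = outputInjection A C L s) ∧
      ∀ x, aeval (outputInjection A C M) ((Polynomial.X - Polynomial.C r) ^ n) x ∈ S := by
  obtain ⟨H, hH⟩ := exists_ker_comp_eq_sup C W
  set AL := outputInjection A C L with hAL
  have hSinv : IsInvariant AL S := hS ▸ isInvariant_unobservableIn _ _
  have hSH : S ≤ LinearMap.ker (H ∘ₗ C) := by rw [hS, hH]; exact unobservableIn_le _ _
  have hshift : IsInvariant (AL - algebraMap ℝ (Module.End ℝ X) r) S := fun s hs =>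
    S.sub_mem (hSinv hs) (S.smul_mem r hs)
  obtain ⟨G, n, hG⟩ := exists_isNilpotent_outputInjection
    (inducedMap (AL - algebraMap ℝ (Module.End ℝ X) r) S hshift) (S.liftQ (H ∘ₗ C) hSH) (by
      intro V hV hVker
      -- Observability of the quotient pair: the preimage of V is A_L-invariant inside W + Ker C,
      -- and S is the largest such subspace.
      have hVS : V.comap S.mkQ ≤ S := by
        conv_rhs => rw [hS, ← hH]
        refine IsInvariant.le_unobservableIn (fun x hx => ?_) fun x hx => hVker hx
        have h1 := V.add_mem (hV hx) (V.smul_mem r hx)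
        rw [Submodule.mem_comap, Submodule.mem_comap]
        convert h1 using 1
        change _ = S.mkQ (AL x - r • x) + r • S.mkQ x
        rw [map_sub, map_smul, sub_add_cancel]
      rw [eq_bot_iff]
      intro y
      induction y using Submodule.Quotient.induction_on with
      | H x =>
        intro hx
        exact (Submodule.mem_bot ℝ).2 ((Submodule.Quotient.mk_eq_zero S).2 (hVS hx)))
  obtain ⟨G', hG'⟩ := Module.projective_lifting_property S.mkQ G S.mkQ_surjective
  -- H C vanishes on S, so the correction is invisible there; modulo S it is the nilpotent-making
  -- injection G.
  refine ⟨L + G' ∘ₗ H, n, fun s hs => ?_, fun x => ?_⟩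
  · have : H (C s) = 0 := hSH hs
    simp [hAL, this]
  · rw [← Submodule.Quotient.mk_eq_zero S, ← Submodule.mkQ_apply, map_pow, map_sub, aeval_X,
      aeval_C]
    have := aeval_semiconj (g := S.mkQ)
      (f := outputInjection A C (L + G' ∘ₗ H) - algebraMap ℝ (Module.End ℝ X) r)
      (f' := outputInjection (inducedMap (AL - algebraMap ℝ (Module.End ℝ X) r) S hshift)
        (S.liftQ (H ∘ₗ C) hSH) G) (fun x => by
          have hGx : G (H (C x)) = S.mkQ (G' (H (C x))) := (LinearMap.congr_fun hG' _).symm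
          change _ = S.mkQ (AL x - r • x) + G (H (C x))
          rw [hGx, ← map_add]
          congr 1
          simp [hAL]
          abel) (Polynomial.X ^ n) x
    rwa [map_pow, map_pow, aeval_X, aeval_X, hG, LinearMap.zero_apply] at this

/-- If `L` is a friend of `W`, `M` is a friend of `V ⊇ W`, and `S ⊆ W + Ker C` is invariant under
`A + L C`, then all polynomials in `A + L C` and `A + M C` agree on `S` modulo `V`. -/
theorem IsFriend.aeval_sub_mem {V S : Submodule ℝ X} {M : Y →ₗ[ℝ] X} (hL : IsFriend A C W L)
    (hM : IsFriend A C V M) (hWV : W ≤ V) (hS : IsInvariant (outputInjection A C L) S)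
    (hSW : S ≤ W ⊔ LinearMap.ker C) (p : ℝ[X]) {x : X} (hx : x ∈ S) :
    aeval (outputInjection A C M) p x - aeval (outputInjection A C L) p x ∈ V := by
  have hpow : ∀ k : ℕ, (outputInjection A C M ^ k) x - (outputInjection A C L ^ k) x ∈ V := by
    intro k
    induction k with
    | zero => simp
    | succ k ih =>
      rw [pow_succ', pow_succ', Module.End.mul_apply, Module.End.mul_apply]
      have h1 := V.add_mem (hM ih) (hL.sub_mem hM hWV (hSW (hS.pow_mem k hx)))
      rwa [map_sub, sub_add_sub_cancel] at h1
  simp only [aeval_eq_sum_range, LinearMap.sum_apply, LinearMap.smul_apply,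
    ← Finset.sum_sub_distrib, ← smul_sub]
  exact V.sum_mem fun k _ => V.smul_mem _ (hpow k)

theorem isLeast_goodFamily [FiniteDimensional ℝ X] {𝓑 S : Submodule ℝ X} {Cg Cb : Set ℂ}
    (hC : IsSymmetricPartition Cg Cb) (hW : IsLeast (conditionedInvariants A C 𝓑) W)
    (hLW : IsFriend A C W L)
    (hS : S = unobservableIn (W ⊔ LinearMap.ker C) (outputInjection A C L))
    (hLS : IsInvariant (outputInjection A C L) S) {βg βb : ℝ[X]}
    (hβ : IsGoodBadFactorization Cg Cb
      (minpoly ℝ (subquotientMap (outputInjection A C L) S W hLS hLW)) βg βb) :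
    IsLeast (goodFamily A C 𝓑 Cg)
      ((modalSubspace (outputInjection A C L) S W hLS hLW βb).comap W.mkQ) := by
  have hWS : W ≤ S := hS ▸ hLW.le_unobservableIn le_sup_left
  have hSW : S ≤ W ⊔ LinearMap.ker C := hS ▸ unobservableIn_le _ _
  have hmem := mem_comap_modalSubspace_iff hLS hLW hWS βb
  set Wg := (modalSubspace (outputInjection A C L) S W hLS hLW βb).comap W.mkQ
  constructor
  · obtain ⟨r, hr⟩ := hC.exists_real_good
    obtain ⟨M, n, hML, hM⟩ := exists_outputInjection_shift_quotient hS r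
    have hWWg : W ≤ Wg := fun w hw =>
      (hmem w).2 ⟨hWS hw, IsInvariant.aeval_mem hLW βb hw⟩
    -- (A_M − r)^n carries X into S; there A_M = A_L, and βg(A_L) carries S into Wg because βb βg =
    -- β sends S into W.
    refine mem_goodFamily_iff.2 ⟨hW.1.2.trans hWWg, M, fun x hx => ?_,
      βg * (Polynomial.X - Polynomial.C r) ^ n, fun x => ?_, fun z hz => ?_⟩
    · obtain ⟨hxS, hxb⟩ := (hmem x).1 hx
      rw [Submodule.mem_comap, hML x hxS]
      refine (hmem _).2 ⟨hLS hxS, ?_⟩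
      rw [← aeval_semiconj (g := outputInjection A C L) (fun _ => rfl)]
      exact hLW hxb
    · rw [map_mul, Module.End.mul_apply]
      set s := aeval (outputInjection A C M) ((Polynomial.X - Polynomial.C r) ^ n) x
      have hs : s ∈ S := hM x
      have hsub : aeval (outputInjection A C M) βg s = aeval (outputInjection A C L) βg s := by
        have h1 := aeval_semiconj (g := S.subtype) (f := (outputInjection A C L).restrict hLS)
          (f' := outputInjection A C M) (fun y => (hML y y.2).symm) βg ⟨s, hs⟩
        have h2 := aeval_semiconj (g := S.subtype) (f := (outputInjection A C L).restrict hLS)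
          (f' := outputInjection A C L) (fun y => rfl) βg ⟨s, hs⟩
        exact h1.symm.trans h2
      rw [hsub]
      refine (hmem _).2 ⟨hLS.aeval_mem βg hs, ?_⟩
      rw [← Module.End.mul_apply, ← map_mul, mul_comm, ← hβ.eq_mul]
      exact aeval_minpoly_subquotientMap_mem hLS hLW hWS hs
    · rw [map_mul, mul_eq_zero] at hz
      rcases hz with hz | hz
      · exact hβ.good z hz
      · have h1 : z - r = 0 := by simpa using eq_zero_of_pow_eq_zero (by simpa using hz)
        exact sub_eq_zero.1 h1 ▸ hr
  · intro V hV x hx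
    obtain ⟨h𝓑V, M, hM, p, hp, hgood⟩ := mem_goodFamily_iff.1 hV
    have hWV : W ≤ V := hW.2 ⟨⟨M, hM⟩, h𝓑V⟩
    obtain ⟨hxS, hxb⟩ := (hmem x).1 hx
    have hb : aeval (outputInjection A C M) βb x ∈ V := by
      have := V.add_mem (hLW.aeval_sub_mem hM hWV hLS hSW βb hxS) (hWV hxb)
      rwa [sub_add_cancel] at this
    -- Bézout: 1 = a p + b βb, and both terms send x into V.
    obtain ⟨a, b, hab⟩ := hC.isCoprime hgood hβ.bad
    have h1 : aeval (outputInjection A C M) (a * p + b * βb) x ∈ V := by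
      rw [map_add, map_mul, map_mul]
      exact V.add_mem (IsInvariant.aeval_mem hM a (hp x)) (IsInvariant.aeval_mem hM b hb)
    rwa [hab, map_one] at h1

end GoodFamily

end GeometricControl

open GeometricControl in
theorem theorem1 {X Y U : Type*}
    [AddCommGroup X] [Module ℝ X] [FiniteDimensional ℝ X]
    [AddCommGroup Y] [Module ℝ Y] [FiniteDimensional ℝ Y]
    [AddCommGroup U] [Module ℝ U] [FiniteDimensional ℝ U]
    (A : X →ₗ[ℝ] X) (C : X →ₗ[ℝ] Y) (B : U →ₗ[ℝ] X)
    (Cg Cb : Set ℂ) (hC : IsSymmetricPartition Cg Cb)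
    (𝓑 W S : Submodule ℝ X) (h𝓑 : 𝓑 = LinearMap.range B)
    (hW : W = wStar A C 𝓑) (hS : S = sStar A C 𝓑) :
    -- the infima `W` and `S` are attained, and `W ⊆ S`
    IsLeast (conditionedInvariants A C 𝓑) W ∧
    IsLeast (unobservabilitySubspaces A C 𝓑) S ∧
    W ≤ S ∧
    -- for every friend `L` of `W`, the map `A_L | S/W` makes sense, its minimal polynomial has a
    -- good-bad factorization, and for every such factorization the inverse image of the bad part
    -- under the canonical projection is the least element of the family
    ∀ (L : Y →ₗ[ℝ] X) (hLW : IsFriend A C W L),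
      ∃ hLS : IsInvariant (outputInjection A C L) S,
        (∃ βg βb : Polynomial ℝ, IsGoodBadFactorization Cg Cb
          (minpoly ℝ (subquotientMap (outputInjection A C L) S W hLS hLW)) βg βb) ∧
        ∀ βg βb : Polynomial ℝ,
          IsGoodBadFactorization Cg Cb
            (minpoly ℝ (subquotientMap (outputInjection A C L) S W hLS hLW)) βg βb →
          IsLeast (goodFamily A C 𝓑 Cg)
            ((modalSubspace (outputInjection A C L) S W hLS hLW βb).comap W.mkQ) := by
  subst hW hS
  have hW := isLeast_wStar A C 𝓑
  obtain ⟨L₀, hL₀⟩ := hW.1.1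
  refine ⟨hW, ?_, ?_, fun L hLW => ?_⟩
  · rw [sStar_eq_unobservableIn hL₀]
    exact isLeast_unobservableIn_sup_ker hW hL₀
  · rw [sStar_eq_unobservableIn hL₀]
    exact hL₀.le_unobservableIn le_sup_left
  · have hS := sStar_eq_unobservableIn hLW
    have hLS : IsInvariant (outputInjection A C L) (sStar A C 𝓑) :=
      hS ▸ isInvariant_unobservableIn _ _
    exact ⟨hLS,
      hC.exists_factorization _ (minpoly.ne_zero (Algebra.IsIntegral.isIntegral _)),
      fun βg βb hβ => isLeast_goodFamily hC hW hLW hS hLS hβ⟩
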